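/- A subset $D$ of a finite group $G$ is a $(v,k,\lambda,\mu)$-partial difference set (PDS) if $|G|=v$, $|D|=k$, every $g\in D$ can be written as $g=d_1d_2^{-1}$ with $(d_1,d_2)\in D\times D$ in exactly $\lambda$ ways, and every $g\in G\setminus(D\cup\{1\})$ can be so written in exactly $\mu$ ways. Theorem. Let $m\ge 2$ be an integer. There exists a nonabelian group $\mathcal{G}$ of order $2^{3m}$ such that, for every integer $r$ with $1\le r<m$, $\mathcal{G}$ contains a PDS with the Denniston parameters \begin{align*} v&=2^{3m},\\ k&=(2^{m+r}-2^m+2^r)(2^m-1),\\ \lambda&=2^m-2^r+(2^{m+r}-2^m+2^r)(2^r-2),\\ \mu&=(2^{m+r}-2^m+2^r)(2^r-1). \end{align*} -/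

import Mathlib

/-- `D` is a `(v, k, l, u)`-partial difference set in the finite group `G`: `G` has order `v`,
`D` has `k` elements, every `g ∈ D` is `d₁ * d₂⁻¹` for exactly `l` ordered pairs
`(d₁, d₂) ∈ D × D`, and every `g ∉ D` other than the identity is so for exactly `u` ordered
pairs. -/
structure IsPDS {G : Type*} [Group G] [Finite G] (D : Set G) (v k l u : ℕ) : Prop where
  card_group : Nat.card G = v
  card_set : D.ncard = k
  count_mem : ∀ g ∈ D, {p : G × G | p.1 ∈ D ∧ p.2 ∈ D ∧ p.1 * p.2⁻¹ = g}.ncard = l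
  count_not_mem : ∀ g ∉ D, g ≠ 1 →
    {p : G × G | p.1 ∈ D ∧ p.2 ∈ D ∧ p.1 * p.2⁻¹ = g}.ncard = u

/-- `D` is a partial difference set with the Denniston parameters for `m` and `r`.
No subtraction below truncates when `1 ≤ r < m`. -/
def IsDennistonPDS {G : Type*} [Group G] [Finite G] (D : Set G) (m r : ℕ) : Prop :=
  IsPDS D
    (2 ^ (3 * m))
    ((2 ^ (m + r) - 2 ^ m + 2 ^ r) * (2 ^ m - 1))
    (2 ^ m - 2 ^ r + (2 ^ (m + r) - 2 ^ m + 2 ^ r) * (2 ^ r - 2))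
    ((2 ^ (m + r) - 2 ^ m + 2 ^ r) * (2 ^ r - 1))

/-! Let `F` have `q = 2 ^ m` elements, let `Q = binForm b` be anisotropic, and let `A` be an
additive subgroup of order `n = 2 ^ r`. Then `{w | Q w ∈ A}` is Denniston's maximal arc: a line
meeting it does so in exactly `n` points (`ncard_line_inter`). In `F² × F`, writing a vector as a
difference of points of the cone over the arc amounts to choosing two arc points on a line through a
fixed point or with a fixed direction, so the cone is a PDS in the elementary abelian group.

To leave the abelian case, let the height `z` act by the shear with parameter `φ z ∈ {0, 1}`. Such
shears preserve `Q`, hence the cone, so the counts of quotients are unchanged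
(`ncard_quotients_shearCone`). The group depends only on `φ`; `r` enters only through `A`. -/

open Classical in
theorem ncard_eq_sum_ncard_fiber {α β : Type*} [Fintype α] [Fintype β] (S : Set (α × β)) :
    S.ncard = ∑ a, {b | (a, b) ∈ S}.ncard := by
  rw [Set.ncard_eq_toFinset_card',
    Finset.card_eq_sum_card_fiberwise (f := Prod.fst) (t := Finset.univ) (by simp)]
  refine Finset.sum_congr rfl fun a _ => ?_
  rw [Set.ncard_eq_toFinset_card']
  refine Finset.card_bij' (fun p _ => p.2) (fun b _ => (a, b)) ?_ ?_ ?_ ?_ <;> aesop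

/-! ### Anisotropic binary forms and maximal arcs -/

section Form

variable {F : Type*} [Field F]

/-- The binary quadratic form `x² + xy + by²`. -/
def binForm (b : F) (w : F × F) : F := w.1 ^ 2 + w.1 * w.2 + b * w.2 ^ 2

theorem binForm_zero (b : F) : binForm b 0 = 0 := by simp [binForm]

theorem binForm_ne_zero {b : F} (hb : ∀ s : F, s ^ 2 + s + b ≠ 0) {w : F × F} (hw : w ≠ 0) :
    binForm b w ≠ 0 := by
  intro h
  unfold binForm at h
  by_cases h2 : w.2 = 0
  · rw [h2] at h
    have h1 : w.1 = 0 := by simpa using h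
    exact hw (Prod.ext h1 h2)
  · apply hb (w.1 / w.2)
    field_simp
    linear_combination h

variable [CharP F 2]

theorem two_eq_zero_of_charP_two : (2 : F) = 0 := by exact_mod_cast CharP.cast_eq_zero F 2

/-- In characteristic two, `s ↦ Q(w + sv) - Q(w)` is additive. -/
def lineHom (b : F) (w v : F × F) : F →+ F where
  toFun s := s * (w.1 * v.2 + w.2 * v.1) + s ^ 2 * binForm b v
  map_zero' := by simp
  map_add' s t := by
    linear_combination (s * t * binForm b v) * two_eq_zero_of_charP_two (F := F)

theorem lineHom_apply (b : F) (w v : F × F) (s : F) :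
    lineHom b w v s = s * (w.1 * v.2 + w.2 * v.1) + s ^ 2 * binForm b v := rfl

theorem binForm_add_smul (b : F) (w v : F × F) (s : F) :
    binForm b (w + s • v) = binForm b w + lineHom b w v s := by
  rw [lineHom_apply]
  simp only [binForm, Prod.fst_add, Prod.snd_add, Prod.smul_fst, Prod.smul_snd, smul_eq_mul]
  linear_combination (w.1 * s * v.1 + b * w.2 * s * v.2) * two_eq_zero_of_charP_two (F := F)

variable [Finite F]

/-- The range of `lineHom` together with `A` generates `F` when `Q(w) ∈ A`. -/
theorem sup_range_lineHom {b : F} (hb : ∀ s : F, s ^ 2 + s + b ≠ 0) (A : AddSubgroup F)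
    {w v : F × F} (hw : binForm b w ∈ A) (hv : v ≠ 0) : A ⊔ (lineHom b w v).range = ⊤ := by
  have hQ := binForm_ne_zero hb hv
  -- The polar form `B(w, v)` decides. If it vanishes, only the injective map `s ↦ s² Q(v)` remains.
  -- Otherwise the range has index two and misses `Q(w)`.
  by_cases hB : w.1 * v.2 + w.2 * v.1 = 0
  · have : Function.Injective (lineHom b w v) := by
      rw [injective_iff_map_eq_zero]
      intro s hs
      rw [lineHom_apply, hB] at hs
      simpa [hQ] using hs
    rw [AddMonoidHom.range_eq_top.2 (Finite.surjective_of_injective this), sup_top_eq]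
  · have hnot : binForm b w ∉ (lineHom b w v).range := by
      rintro ⟨s, hs⟩
      -- If `Q(w)` were in the range, the line would pass through the only zero of `Q`, the origin,
      -- making `w` and `v` proportional.
      have h0 : binForm b (w + s • v) = 0 := by
        rw [binForm_add_smul, hs, CharTwo.add_self_eq_zero]
      have h1 : w + s • v = 0 := by
        by_contra h
        exact binForm_ne_zero hb h h0
      have e1 := congrArg Prod.fst h1
      have e2 := congrArg Prod.snd h1
      simp only [Prod.fst_add, Prod.snd_add, Prod.smul_fst, Prod.smul_snd, smul_eq_mul,
        Prod.fst_zero, Prod.snd_zero] at e1 e2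
      apply hB
      linear_combination v.2 * e1 + v.1 * e2 - s * v.1 * v.2 * two_eq_zero_of_charP_two (F := F)
    have hker : ((lineHom b w v).ker : Set F) ⊆
        {0, (w.1 * v.2 + w.2 * v.1) / binForm b v} := by
      intro s hs
      have hs' : lineHom b w v s = 0 := hs
      rw [lineHom_apply] at hs'
      by_cases h0 : s = 0
      · exact Or.inl h0
      · right
        rw [Set.mem_singleton_iff, eq_div_iff hQ]
        have : s * (s * binForm b v + (w.1 * v.2 + w.2 * v.1)) = 0 := by linear_combination hs'
        have h3 := (mul_eq_zero.1 this).resolve_left h0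
        exact CharTwo.add_eq_zero.1 h3
    have hle : (lineHom b w v).range.index ≤ 2 := by
      rw [AddSubgroup.index_range, ← SetLike.coe_sort_coe, Nat.card_coe_set_eq]
      exact (Set.ncard_le_ncard hker (Set.toFinite _)).trans ((Set.ncard_insert_le _ _).trans (by rw [Set.ncard_singleton]))
    have h2 : (lineHom b w v).range.index = 2 := by
      have h0 : (lineHom b w v).range.index ≠ 0 := AddSubgroup.FiniteIndex.index_ne_zero
      have h1 : (lineHom b w v).range.index ≠ 1 := by
        rw [Ne, AddSubgroup.index_eq_one]
        intro h
        exact hnot (h ▸ AddSubgroup.mem_top _)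
      omega
    rw [eq_top_iff]
    intro y _
    by_cases hy : y ∈ (lineHom b w v).range
    · exact AddSubgroup.mem_sup_right hy
    -- Two elements outside a subgroup of index two have their sum inside it.
    · have h3 : binForm b w + y ∈ (lineHom b w v).range := by
        rw [AddSubgroup.add_mem_iff_of_index_two h2]; simp [hnot, hy]
      have h4 := add_mem (AddSubgroup.mem_sup_left (T := (lineHom b w v).range) hw)
        (AddSubgroup.mem_sup_right (S := A) h3)
      rwa [← add_assoc, CharTwo.add_self_eq_zero, zero_add] at h4

/-- Every line through a point of `{w | Q(w) ∈ A}` meets this set in exactly `|A|` points. -/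
theorem ncard_line_inter {b : F} (hb : ∀ s : F, s ^ 2 + s + b ≠ 0) (A : AddSubgroup F)
    {w v : F × F} (hw : binForm b w ∈ A) (hv : v ≠ 0) :
    {s : F | binForm b (w + s • v) ∈ A}.ncard = Nat.card A := by
  have hset : {s : F | binForm b (w + s • v) ∈ A} = (A.comap (lineHom b w v) : Set F) := by
    ext s
    simp only [Set.mem_ofPred_eq, binForm_add_smul, AddSubgroup.coe_comap, Set.mem_preimage,
      SetLike.mem_coe]
    exact add_mem_cancel_left hw
  rw [hset, ← Nat.card_coe_set_eq, SetLike.coe_sort_coe]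
  -- The index of the preimage is that of `A` in `A ⊔ range`, which is all of `F`.
  have hidx : (A.comap (lineHom b w v)).index = A.index := by
    rw [AddSubgroup.index_comap, ← AddSubgroup.relIndex_sup_left, sup_range_lineHom hb A hw hv,
      AddSubgroup.relIndex_top_right]
  have h1 := AddSubgroup.card_mul_index (A.comap (lineHom b w v))
  rw [hidx, ← AddSubgroup.card_mul_index A] at h1
  exact Nat.eq_of_mul_eq_mul_right
    (Nat.pos_of_ne_zero AddSubgroup.FiniteIndex.index_ne_zero) h1

/-- The points other than `w` on a line through `w`. -/
theorem ncard_line_inter_ne_zero {b : F} (hb : ∀ s : F, s ^ 2 + s + b ≠ 0) (A : AddSubgroup F)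
    {w v : F × F} (hw : binForm b w ∈ A) (hv : v ≠ 0) :
    {s : F | s ≠ 0 ∧ binForm b (w + s • v) ∈ A}.ncard = Nat.card A - 1 := by
  rw [← ncard_line_inter hb A hw hv, ← Set.ncard_sdiff_singleton_of_mem (a := (0 : F))]
  · congr 1; ext s; simp [and_comm]
  · simpa using hw

/-- The points other than `w` and `w + v` on the line through these two points. -/
theorem ncard_line_inter_ne_zero_ne_one {b : F} (hb : ∀ s : F, s ^ 2 + s + b ≠ 0)
    (A : AddSubgroup F) {w v : F × F} (hw : binForm b w ∈ A) (hv : v ≠ 0)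
    (hwv : binForm b (w + v) ∈ A) :
    {s : F | s ≠ 0 ∧ s ≠ 1 ∧ binForm b (w + s • v) ∈ A}.ncard = Nat.card A - 2 := by
  rw [show Nat.card A - 2 = Nat.card A - 1 - 1 by omega, ← ncard_line_inter_ne_zero hb A hw hv,
    ← Set.ncard_sdiff_singleton_of_mem (a := (1 : F))]
  · congr 1; ext s
    simp only [Set.mem_ofPred_eq, Set.mem_sdiff, Set.mem_singleton_iff]
    tauto
  · simpa using hwv

/-- The number of points of the arc `{w | Q(w) ∈ A}`. -/
theorem ncard_arc [Fintype F] {b : F} (hb : ∀ s : F, s ^ 2 + s + b ≠ 0) (A : AddSubgroup F) :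
    {w : F × F | binForm b w ∈ A}.ncard = Nat.card A + Nat.card F * (Nat.card A - 1) := by
  -- The `q + 1` lines through the origin cover the plane. The origin lies in the arc and is counted
  -- only on the axis `y = 0`; the other `q` lines contribute `|A| - 1` points each.
  have hsplit : {w : F × F | binForm b w ∈ A} =
      (fun s : F => (s, (0 : F))) '' {s | binForm b (0 + s • ((1, 0) : F × F)) ∈ A} ∪
      (fun p : F × F => p.2 • ((p.1, 1) : F × F)) ''
        {p | p.2 ≠ 0 ∧ binForm b (0 + p.2 • ((p.1, 1) : F × F)) ∈ A} := by
    ext ⟨x, y⟩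
    simp only [Set.mem_ofPred_eq, Set.mem_union, Set.mem_image, zero_add, Prod.exists]
    constructor
    · intro h
      by_cases hy : y = 0
      · left; exact ⟨x, by simpa [hy] using h, by simp [hy]⟩
      · right
        have e : y • ((x / y, 1) : F × F) = (x, y) := by
          ext <;> simp [mul_div_cancel₀, hy]
        exact ⟨x / y, y, ⟨hy, by rwa [e]⟩, e⟩
    · rintro (⟨s, h, e⟩ | ⟨s, t, ⟨_, h⟩, e⟩)
      · rw [← e]; simpa using h
      · rwa [← e]
  rw [hsplit, Set.ncard_union_eq, Set.ncard_image_of_injective, ncard_line_inter hb,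
    Set.InjOn.ncard_image, ncard_eq_sum_ncard_fiber]
  · congr 1
    simp only [Set.mem_ofPred_eq]
    rw [Finset.sum_congr rfl fun s _ => ncard_line_inter_ne_zero hb A (w := 0) (v := (s, 1))
      (by simp [binForm_zero]) (by simp)]
    simp
  · rintro ⟨s, t⟩ ⟨h, -⟩ ⟨s', t'⟩ - e
    simp only [Prod.smul_mk, smul_eq_mul, mul_one, Prod.mk.injEq] at e
    obtain ⟨e, rfl⟩ := e
    simpa [show t ≠ 0 from h] using e
  · simp [binForm_zero]
  · simp
  · intro s t h; simpa using h
  · rw [Set.disjoint_left]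
    rintro _ ⟨s, -, rfl⟩ ⟨⟨s', t⟩, ⟨h, -⟩, e⟩
    simp only [Prod.smul_mk, smul_eq_mul, mul_one, Prod.mk.injEq] at e
    exact h e.2

end Form

/-! ### Difference counts for the cone in `F² × F` -/

section Cone

variable {F : Type*} [Field F]

/-- The cone over the arc `{w | Q(w) ∈ A}` in the plane at height one, without its vertex. -/
def dennistonCone (b : F) (A : AddSubgroup F) : Set ((F × F) × F) :=
  {d | d.2 ≠ 0 ∧ binForm b (d.2⁻¹ • d.1) ∈ A}

theorem mem_dennistonCone {b : F} {A : AddSubgroup F} {w : F × F} {z : F} :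
    (w, z) ∈ dennistonCone b A ↔ z ≠ 0 ∧ binForm b (z⁻¹ • w) ∈ A := Iff.rfl

variable [CharP F 2] {b : F}

/-- Projecting to height one, the cone points `(z • w, z)` and `(z • w + t • u, z + t)` lie over `w`
and over the point of the line through `w` and `u` with parameter `s = t / (z + t)`. Solving gives
`z = t(1 + s⁻¹)`; `t ≠ 0` forces `s ≠ 0`, and `z ≠ 0` means `s ≠ 1`. -/
theorem cone_inter_translate_eq_image (A : AddSubgroup F) (u : F × F) {t : F} (ht : t ≠ 0) :
    {d | d ∈ dennistonCone b A ∧ d + (t • u, t) ∈ dennistonCone b A} =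
      (fun p : (F × F) × F => ((t * (1 + p.2⁻¹)) • p.1, t * (1 + p.2⁻¹))) ''
      {p | binForm b p.1 ∈ A ∧ p.2 ≠ 0 ∧ p.2 ≠ 1 ∧ binForm b (p.1 + p.2 • (p.1 + u)) ∈ A} := by
  have h2 := two_eq_zero_of_charP_two (F := F)
  have key : ∀ (w : F × F) (s : F), s ≠ 0 →
      (t * s⁻¹)⁻¹ • ((t * (1 + s⁻¹)) • w + t • u) = w + s • (w + u) := by
    intro w s hs
    ext
    · simp only [Prod.smul_fst, Prod.fst_add, smul_eq_mul]
      field_simp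
      ring
    · simp only [Prod.smul_snd, Prod.snd_add, smul_eq_mul]
      field_simp
      ring
  have hsum : ∀ s : F, t * (1 + s⁻¹) + t = t * s⁻¹ := fun s => by linear_combination t * h2
  have hne : ∀ s : F, s ≠ 0 → s ≠ 1 → t * (1 + s⁻¹) ≠ 0 := by
    intro s hs hs1
    refine mul_ne_zero ht fun h => hs1 ?_
    rw [CharTwo.add_eq_zero] at h
    rw [← inv_inv s, ← h, inv_one]
  ext ⟨w, z⟩
  simp only [mem_dennistonCone, Set.mem_image, Set.mem_ofPred_eq, Prod.mk_add_mk,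
    Prod.mk.injEq]
  constructor
  · rintro ⟨⟨hz, h⟩, hzt, h'⟩
    have hs : t / (z + t) ≠ 0 := div_ne_zero ht hzt
    have hz' : t * (1 + (t / (z + t))⁻¹) = z := by
      field_simp
      linear_combination t * h2
    refine ⟨(z⁻¹ • w, t / (z + t)), ⟨h, hs, ?_, ?_⟩, ?_, hz'⟩
    · rw [Ne, div_eq_one_iff_eq hzt]
      intro e
      exact hz (by linear_combination -e)
    · rw [← key _ _ hs, hz', smul_inv_smul₀ hz, inv_div, mul_div_cancel₀ _ ht]
      exact h'
    · rw [hz', smul_inv_smul₀ hz]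
  · rintro ⟨⟨w', s⟩, ⟨h, hs, hs1, h'⟩, rfl, rfl⟩
    rw [hsum, key _ _ hs, inv_smul_smul₀ (hne s hs hs1)]
    exact ⟨⟨hne s hs hs1, h⟩, mul_ne_zero ht (inv_ne_zero hs), h'⟩

variable [Fintype F]

theorem ncard_dennistonCone (hb : ∀ s : F, s ^ 2 + s + b ≠ 0)
    (A : AddSubgroup F) : (dennistonCone b A).ncard =
    (Nat.card A + Nat.card F * (Nat.card A - 1)) * (Nat.card F - 1) := by
  have himg : dennistonCone b A = (fun p : (F × F) × F => (p.2 • p.1, p.2)) ''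
      ({w : F × F | binForm b w ∈ A} ×ˢ ({0}ᶜ : Set F)) := by
    ext ⟨w, z⟩
    simp only [mem_dennistonCone, Set.mem_image, Set.mem_prod, Set.mem_ofPred_eq,
      Set.mem_compl_iff, Set.mem_singleton_iff, Prod.mk.injEq]
    constructor
    · rintro ⟨hz, h⟩
      exact ⟨(z⁻¹ • w, z), ⟨h, hz⟩, smul_inv_smul₀ hz w, rfl⟩
    · rintro ⟨⟨w', z⟩, ⟨h, hz⟩, rfl, rfl⟩
      exact ⟨hz, by rwa [inv_smul_smul₀ hz]⟩
  rw [himg, Set.InjOn.ncard_image, Set.ncard_prod, ncard_arc hb, Set.ncard_compl,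
    Set.ncard_singleton]
  rintro ⟨w, z⟩ ⟨-, hz⟩ ⟨w', z'⟩ - e
  simp only [Prod.mk.injEq] at e
  obtain ⟨e, rfl⟩ := e
  rw [smul_right_injective _ hz e]

/-- Representations of a horizontal vector. -/
theorem ncard_cone_inter_translate_horizontal (hb : ∀ s : F, s ^ 2 + s + b ≠ 0)
    (A : AddSubgroup F) {u : F × F} (hu : u ≠ 0) :
    {d | d ∈ dennistonCone b A ∧ d + (u, 0) ∈ dennistonCone b A}.ncard =
      (Nat.card A + Nat.card F * (Nat.card A - 1)) * (Nat.card A - 1) := by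
  classical
  -- The height is unchanged, so after projection the translate moves along direction `u` with
  -- parameter `s = z⁻¹`.
  have himg : {d | d ∈ dennistonCone b A ∧ d + (u, 0) ∈ dennistonCone b A} =
      (fun p : (F × F) × F => (p.2⁻¹ • p.1, p.2⁻¹)) ''
      {p | binForm b p.1 ∈ A ∧ p.2 ≠ 0 ∧ binForm b (p.1 + p.2 • u) ∈ A} := by
    ext ⟨w, z⟩
    simp only [mem_dennistonCone, Set.mem_image, Set.mem_ofPred_eq, Prod.mk_add_mk, add_zero,
      Prod.mk.injEq]
    constructor
    · rintro ⟨⟨hz, h⟩, -, h'⟩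
      refine ⟨(z⁻¹ • w, z⁻¹), ⟨h, inv_ne_zero hz, by rwa [← smul_add]⟩, ?_, inv_inv z⟩
      rw [inv_inv, smul_inv_smul₀ hz]
    · rintro ⟨⟨w', s⟩, ⟨h, hs, h'⟩, rfl, rfl⟩
      rw [inv_inv, smul_add, smul_inv_smul₀ hs]
      exact ⟨⟨inv_ne_zero hs, h⟩, inv_ne_zero hs, h'⟩
  rw [himg, Set.InjOn.ncard_image, ncard_eq_sum_ncard_fiber]
  · simp only [Set.mem_ofPred_eq]
    rw [Finset.sum_congr rfl (g := fun w => if binForm b w ∈ A then Nat.card A - 1 else 0),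
      Finset.sum_ite, Finset.sum_const_zero, Finset.sum_const, add_zero, smul_eq_mul,
      ← ncard_arc hb A, Set.ncard_eq_toFinset_card', Set.toFinset_ofPred]
    intro w _
    split_ifs with h
    · simp only [h, true_and]
      exact ncard_line_inter_ne_zero hb A h hu
    · simp [h]
  · rintro ⟨w, z⟩ ⟨-, hz, -⟩ ⟨w', z'⟩ - e
    simp only [Prod.mk.injEq, inv_inj] at e
    obtain ⟨e, rfl⟩ := e
    rw [smul_right_injective _ (inv_ne_zero hz) e]

theorem ncard_cone_inter_translate (A : AddSubgroup F) (u : F × F) {t : F} (ht : t ≠ 0) :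
    {d | d ∈ dennistonCone b A ∧ d + (t • u, t) ∈ dennistonCone b A}.ncard =
      ∑ w : F × F,
        {s : F | binForm b w ∈ A ∧ s ≠ 0 ∧ s ≠ 1 ∧ binForm b (w + s • (w + u)) ∈ A}.ncard := by
  rw [cone_inter_translate_eq_image A u ht, Set.InjOn.ncard_image, ncard_eq_sum_ncard_fiber]
  · rfl
  · rintro ⟨w, s⟩ ⟨-, hs, hs1, -⟩ ⟨w', s'⟩ - e
    simp only [Prod.mk.injEq] at hs hs1 e
    obtain ⟨e, e'⟩ := e
    obtain rfl : s = s' := by simpa [ht] using e'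
    have hne : t * (1 + s⁻¹) ≠ 0 := by
      refine mul_ne_zero ht fun h => hs1 ?_
      rw [CharTwo.add_eq_zero] at h
      rw [← inv_inv s, ← h, inv_one]
    rw [smul_right_injective _ hne e]

/-- Since `u` is off the arc, the excluded parameter `s = 1`, which gives `u` itself, costs nothing:
each arc point `w` has `|A| - 1` partners on its line to `u`. -/
theorem ncard_cone_inter_translate_of_notMem (hb : ∀ s : F, s ^ 2 + s + b ≠ 0)
    (A : AddSubgroup F) {u : F × F} {t : F} (ht : t ≠ 0)
    (hu : binForm b u ∉ A) :
    {d | d ∈ dennistonCone b A ∧ d + (t • u, t) ∈ dennistonCone b A}.ncard =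
      (Nat.card A + Nat.card F * (Nat.card A - 1)) * (Nat.card A - 1) := by
  classical
  rw [ncard_cone_inter_translate A u ht,
    Finset.sum_congr rfl (g := fun w => if binForm b w ∈ A then Nat.card A - 1 else 0),
    Finset.sum_ite, Finset.sum_const_zero, Finset.sum_const, add_zero, smul_eq_mul,
    ← ncard_arc hb A, Set.ncard_eq_toFinset_card', Set.toFinset_ofPred]
  intro w _
  split_ifs with h
  · have hne : w + u ≠ 0 := by
      rw [Ne, CharTwo.add_eq_zero]
      rintro rfl
      exact hu h
    rw [← ncard_line_inter_ne_zero hb A h hne]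
    congr 1
    ext s
    simp only [Set.mem_ofPred_eq, h, true_and]
    constructor
    · exact fun ⟨h0, _, h'⟩ => ⟨h0, h'⟩
    · rintro ⟨h0, h'⟩
      refine ⟨h0, ?_, h'⟩
      rintro rfl
      rw [one_smul, ← add_assoc, CharTwo.add_self_eq_zero, zero_add] at h'
      exact hu h'
  · simp [h]

/-- Each arc point `w ≠ u` loses both `w` and `u` from the `|A|` arc points on their line. For `w =
u` the line degenerates to a point and every `s ≠ 0, 1` counts, whence `q - 2`. -/
theorem ncard_cone_inter_translate_of_mem (hb : ∀ s : F, s ^ 2 + s + b ≠ 0)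
    (A : AddSubgroup F) {u : F × F} {t : F} (ht : t ≠ 0)
    (hu : binForm b u ∈ A) :
    {d | d ∈ dennistonCone b A ∧ d + (t • u, t) ∈ dennistonCone b A}.ncard =
      (Nat.card F - 2) +
        (Nat.card A + Nat.card F * (Nat.card A - 1) - 1) * (Nat.card A - 2) := by
  classical
  rw [ncard_cone_inter_translate A u ht, ← Finset.add_sum_erase _ _ (Finset.mem_univ u)]
  congr 1
  · have : {s : F | binForm b u ∈ A ∧ s ≠ 0 ∧ s ≠ 1 ∧ binForm b (u + s • (u + u)) ∈ A} =
        ({0, 1} : Set F)ᶜ := by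
      ext s
      rw [CharTwo.add_self_eq_zero]
      simp [hu]
    rw [this, Set.ncard_compl, Set.ncard_pair zero_ne_one]
  · rw [Finset.sum_congr rfl (g := fun w => if binForm b w ∈ A then Nat.card A - 2 else 0),
      Finset.sum_ite, Finset.sum_const_zero, Finset.sum_const, add_zero, smul_eq_mul,
      ← ncard_arc hb A, Set.ncard_eq_toFinset_card', Set.toFinset_ofPred,
      Finset.filter_erase, Finset.card_erase_of_mem (by simpa using hu)]
    intro w hw
    split_ifs with h
    · simp only [h, true_and]
      apply ncard_line_inter_ne_zero_ne_one hb A h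
      · rw [Ne, CharTwo.add_eq_zero]
        exact Finset.ne_of_mem_erase hw
      · rwa [← add_assoc, CharTwo.add_self_eq_zero, zero_add]
    · simp [h]

end Cone

/-! ### The nonabelian group and transfer of the counts -/

section Shear

variable {F : Type*} [Field F]

/-- The set `F² × F`, on which `z` in the last factor acts on `F²` by the shear
`(x, y) ↦ (x + φ(z)y, y)`. -/
structure ShearGroup (φ : F →+ F) where
  /-- The planar part. -/
  vec : F × F
  /-- The acting part. -/
  ht : F

namespace ShearGroup

variable {φ : F →+ F}

@[ext]
theorem ext {g h : ShearGroup φ} (h₁ : g.vec = h.vec) (h₂ : g.ht = h.ht) : g = h := by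
  cases g; cases h; simp_all

/-- The underlying set of `ShearGroup φ`. -/
def equivProd (φ : F →+ F) : ShearGroup φ ≃ (F × F) × F where
  toFun g := (g.vec, g.ht)
  invFun p := ⟨p.1, p.2⟩

instance [Finite F] : Finite (ShearGroup φ) := Finite.of_equiv _ (equivProd φ).symm

/-- The shear `(x, y) ↦ (x + cy, y)`. -/
def shear (c : F) (w : F × F) : F × F := (w.1 + c * w.2, w.2)

theorem shear_add (c : F) (w w' : F × F) : shear c (w + w') = shear c w + shear c w' := by
  ext
  · simp only [shear, Prod.fst_add, Prod.snd_add]; ring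
  · simp [shear]

theorem shear_shear (c c' : F) (w : F × F) : shear c (shear c' w) = shear (c + c') w := by
  ext
  · simp only [shear]; ring
  · simp [shear]

theorem shear_zero (w : F × F) : shear 0 w = w := by simp [shear]

theorem shear_smul (c a : F) (w : F × F) : shear c (a • w) = a • shear c w := by
  ext
  · simp only [shear, Prod.smul_fst, Prod.smul_snd, smul_eq_mul]; ring
  · simp [shear]

/-- The semidirect product of `F²` and `F`. -/
instance : Group (ShearGroup φ) where
  mul g h := ⟨g.vec + shear (φ g.ht) h.vec, g.ht + h.ht⟩
  one := ⟨0, 0⟩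
  inv g := ⟨shear (-φ g.ht) (-g.vec), -g.ht⟩
  mul_assoc f g h := by
    refine ShearGroup.ext ?_ (add_assoc _ _ _)
    change f.vec + shear (φ f.ht) g.vec + shear (φ (f.ht + g.ht)) h.vec =
      f.vec + shear (φ f.ht) (g.vec + shear (φ g.ht) h.vec)
    rw [shear_add, shear_shear, map_add, add_assoc]
  one_mul g := by
    refine ShearGroup.ext ?_ (zero_add _)
    change 0 + shear (φ 0) g.vec = g.vec
    rw [map_zero, shear_zero, zero_add]
  mul_one g := by
    refine ShearGroup.ext ?_ (add_zero _)
    change g.vec + shear (φ g.ht) 0 = g.vec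
    simp [shear]
  inv_mul_cancel g := by
    refine ShearGroup.ext ?_ (neg_add_cancel _)
    change shear (-φ g.ht) (-g.vec) + shear (φ (-g.ht)) g.vec = 0
    rw [map_neg, ← shear_add, neg_add_cancel]
    simp [shear]

theorem vec_mul (g h : ShearGroup φ) : (g * h).vec = g.vec + shear (φ g.ht) h.vec := rfl

theorem ht_mul (g h : ShearGroup φ) : (g * h).ht = g.ht + h.ht := rfl

theorem exists_not_commute {z : F} (hz : φ z ≠ 0) : ∃ a b : ShearGroup φ, a * b ≠ b * a := by
  refine ⟨⟨0, z⟩, ⟨(0, 1), 0⟩, fun h => hz ?_⟩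
  have := congrArg (fun g => g.vec.1) h
  simpa [vec_mul, shear] using this

end ShearGroup

open ShearGroup

/-- In characteristic two the shear changes `Q` by `(c² + c)y²`, which is zero for `c` in the prime
field. -/
theorem binForm_shear [CharP F 2] (b : F) {c : F} (hc : c = 0 ∨ c = 1) (w : F × F) :
    binForm b (shear c w) = binForm b w := by
  rcases hc with rfl | rfl
  · rw [shear_zero]
  · simp only [binForm, shear]
    linear_combination (w.1 * w.2 + w.2 ^ 2) * two_eq_zero_of_charP_two (F := F)

variable {φ : F →+ F}

/-- `dennistonCone` as a subset of `ShearGroup φ`. -/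
def shearCone (φ : F →+ F) (b : F) (A : AddSubgroup F) : Set (ShearGroup φ) :=
  equivProd φ ⁻¹' dennistonCone b A

theorem mem_shearCone {b : F} {A : AddSubgroup F} {g : ShearGroup φ} :
    g ∈ shearCone φ b A ↔ (g.vec, g.ht) ∈ dennistonCone b A := Iff.rfl

/-- As shears by `φ` preserve the cone, quotients in `ShearGroup φ` of its elements are counted
by the differences in `F² × F`. -/
theorem ncard_quotients_shearCone [CharP F 2] (hφ : ∀ z, φ z = 0 ∨ φ z = 1) (b : F)
    (A : AddSubgroup F) (g : ShearGroup φ) :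
    {p : ShearGroup φ × ShearGroup φ |
      p.1 ∈ shearCone φ b A ∧ p.2 ∈ shearCone φ b A ∧ p.1 * p.2⁻¹ = g}.ncard =
    {d | d ∈ dennistonCone b A ∧ d + (g.vec, g.ht) ∈ dennistonCone b A}.ncard := by
  have hsh : ∀ (c : F), c = 0 ∨ c = 1 → ∀ (w : F × F) (z : F),
      (shear c w, z) ∈ dennistonCone b A ↔ (w, z) ∈ dennistonCone b A := by
    intro c hc w z
    rw [mem_dennistonCone, mem_dennistonCone, ← shear_smul, binForm_shear b hc]
  have hinv : ∀ w, shear (φ g.ht) (shear (φ g.ht) w) = w := by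
    intro w
    rw [shear_shear, CharTwo.add_self_eq_zero, shear_zero]
  -- A pair `(p, q)` is determined by `q`, as `p = g * q`. If `d` is `q` with its planar part
  -- sheared by `φ g.ht`, then `g * q` has the coordinates of `d + g` in `F² × F`. This shear is an
  -- involution preserving the cone.
  refine Set.ncard_congr (fun p _ => (shear (φ g.ht) p.2.vec, p.2.ht)) ?_ ?_ ?_
  · rintro ⟨p, q⟩ ⟨hp, hq, h⟩
    obtain rfl : p = g * q := mul_inv_eq_iff_eq_mul.1 h
    refine ⟨(hsh _ (hφ _) _ _).2 hq, ?_⟩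
    simp only [mem_shearCone, vec_mul, ht_mul] at hp
    rwa [Prod.mk_add_mk, add_comm, add_comm q.ht]
  · rintro ⟨p, q⟩ ⟨p', q'⟩ ⟨-, -, h⟩ ⟨-, -, h'⟩ e
    obtain rfl : p = g * q := mul_inv_eq_iff_eq_mul.1 h
    obtain rfl : p' = g * q' := mul_inv_eq_iff_eq_mul.1 h'
    simp only [Prod.mk.injEq] at e
    have e1 := congrArg (shear (φ g.ht)) e.1
    rw [hinv, hinv] at e1
    rw [ShearGroup.ext e1 e.2]
  · rintro ⟨w, z⟩ ⟨h, h'⟩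
    refine ⟨(g * ⟨shear (φ g.ht) w, z⟩, ⟨shear (φ g.ht) w, z⟩), ⟨?_, ?_, by group⟩, ?_⟩
    · rw [mem_shearCone, vec_mul, ht_mul, hinv, add_comm, add_comm g.ht]
      exact h'
    · exact (hsh _ (hφ _) _ _).2 h
    · simp only [hinv]

/-- The cone over the arc is a partial difference set in `ShearGroup φ`. -/
theorem isPDS_shearCone [CharP F 2] [Fintype F] (hφ : ∀ z, φ z = 0 ∨ φ z = 1) {b : F}
    (hb : ∀ s : F, s ^ 2 + s + b ≠ 0) (A : AddSubgroup F) :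
    IsPDS (shearCone φ b A) (Nat.card F ^ 3)
      ((Nat.card A + Nat.card F * (Nat.card A - 1)) * (Nat.card F - 1))
      ((Nat.card F - 2) +
        (Nat.card A + Nat.card F * (Nat.card A - 1) - 1) * (Nat.card A - 2))
      ((Nat.card A + Nat.card F * (Nat.card A - 1)) * (Nat.card A - 1)) where
  card_group := by
    rw [Nat.card_congr (equivProd φ), Nat.card_prod, Nat.card_prod]; ring
  card_set := by
    rw [← ncard_dennistonCone hb A, shearCone,
      Set.ncard_preimage_of_injective_subset_range (equivProd φ).injective (by simp)]
  count_mem g hg := by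
    obtain ⟨hz, hu⟩ := mem_dennistonCone.1 (mem_shearCone.1 hg)
    rw [ncard_quotients_shearCone hφ, ← ncard_cone_inter_translate_of_mem hb A hz hu,
      smul_inv_smul₀ hz]
  count_not_mem g hg hg1 := by
    rw [ncard_quotients_shearCone hφ]
    by_cases hz : g.ht = 0
    · rw [hz]
      refine ncard_cone_inter_translate_horizontal hb A fun hu => hg1 ?_
      exact ShearGroup.ext hu hz
    · rw [mem_shearCone, mem_dennistonCone, not_and] at hg
      rw [← ncard_cone_inter_translate_of_notMem hb A hz (hg hz), smul_inv_smul₀ hz]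

end Shear

/-! ### Choice of `b`, `φ` and `A`, and the parameters -/

/-- A finite field of characteristic two carries an irreducible polynomial `s² + s + b`. -/
theorem exists_forall_sq_add_self_add_ne_zero (F : Type*) [Field F] [Finite F] [CharP F 2] :
    ∃ b : F, ∀ s : F, s ^ 2 + s + b ≠ 0 := by
  -- The map `s ↦ s² + s` identifies `0` and `1`; by finiteness it misses some value, which serves
  -- as `b`.
  have hinj : ¬ Function.Injective fun s : F => s ^ 2 + s := by
    intro h
    have : (0 : F) = 1 := h (by simp [CharTwo.add_self_eq_zero])
    exact zero_ne_one this
  have hsurj : ¬ Function.Surjective fun s : F => s ^ 2 + s :=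
    fun h => hinj (Finite.injective_iff_surjective.2 h)
  rw [Function.Surjective, not_forall] at hsurj
  obtain ⟨b, hb⟩ := hsurj
  exact ⟨b, fun s hs => hb ⟨s, CharTwo.add_eq_zero.1 hs⟩⟩

/-- A field of characteristic two has an additive endomorphism with values `0` and `1` that does
not vanish at `1`. -/
theorem exists_addMonoidHom_zero_or_one (F : Type*) [Field F] [CharP F 2] :
    ∃ φ : F →+ F, (∀ z, φ z = 0 ∨ φ z = 1) ∧ φ 1 ≠ 0 := by
  let _ : Algebra (ZMod 2) F := ZMod.algebra F 2
  have h : ¬ ∀ f : Module.Dual (ZMod 2) F, f 1 = 0 := by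
    rw [Module.forall_dual_apply_eq_zero_iff]
    exact one_ne_zero
  obtain ⟨f, hf⟩ := not_forall.1 h
  have hval : ∀ c : ZMod 2, c = 0 ∨ c = 1 := by decide
  refine ⟨(algebraMap (ZMod 2) F).toAddMonoidHom.comp f.toAddMonoidHom, fun z => ?_, ?_⟩
  · change algebraMap (ZMod 2) F (f z) = 0 ∨ algebraMap (ZMod 2) F (f z) = 1
    rcases hval (f z) with h | h <;> simp [h]
  · change algebraMap (ZMod 2) F (f 1) ≠ 0
    simpa using hf

theorem AddSubgroup.exists_card_eq_pow_prime {M : Type*} [AddGroup M] [Finite M] (p : ℕ)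
    [Fact p.Prime] {n : ℕ} (h : p ^ n ∣ Nat.card M) : ∃ A : AddSubgroup M, Nat.card A = p ^ n := by
  obtain ⟨K, hK⟩ := Sylow.exists_subgroup_card_pow_prime (G := Multiplicative M) p (n := n) h
  exact ⟨Subgroup.toAddSubgroup' K, hK⟩

theorem theorem6p2 (m : ℕ) (hm : 2 ≤ m) :
    ∃ (G : Type) (_ : Group G) (_ : Finite G),
      (∃ a b : G, a * b ≠ b * a) ∧
      ∀ r : ℕ, 1 ≤ r → r < m → ∃ D : Set G, IsDennistonPDS D m r := by
  have hq : Nat.card (GaloisField 2 m) = 2 ^ m := GaloisField.card 2 m (by omega)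
  have : Fintype (GaloisField 2 m) := Fintype.ofFinite _
  obtain ⟨b, hb⟩ := exists_forall_sq_add_self_add_ne_zero (GaloisField 2 m)
  obtain ⟨φ, hφ, hφ1⟩ := exists_addMonoidHom_zero_or_one (GaloisField 2 m)
  refine ⟨ShearGroup φ, inferInstance, inferInstance, ShearGroup.exists_not_commute hφ1,
    fun r hr hrm => ?_⟩
  obtain ⟨A, hA⟩ := AddSubgroup.exists_card_eq_pow_prime (M := GaloisField 2 m) 2 (n := r)
    (by rw [hq]; exact pow_dvd_pow 2 hrm.le)
  refine ⟨shearCone φ b A, ?_⟩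
  have h := isPDS_shearCone hφ hb A
  rw [hq, hA] at h
  have hn : 2 ≤ 2 ^ r := by simpa using Nat.pow_le_pow_right (n := 2) (by norm_num) hr
  have hnq : 2 ^ r ≤ 2 ^ m := Nat.pow_le_pow_right (by norm_num) hrm.le
  have e1 : 2 ^ (m + r) - 2 ^ m + 2 ^ r = 2 ^ r + 2 ^ m * (2 ^ r - 1) := by
    rw [pow_add, Nat.mul_sub, mul_one, add_comm]
  -- With `N` points on the arc this reads `q - n + N(n - 2) = q - 2 + (N - 1)(n - 2)`. Writing `n =
  -- 2 + k` and `q = n + l` removes the truncated subtractions.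
  have e2 : 2 ^ m - 2 ^ r + (2 ^ r + 2 ^ m * (2 ^ r - 1)) * (2 ^ r - 2) =
      2 ^ m - 2 + (2 ^ r + 2 ^ m * (2 ^ r - 1) - 1) * (2 ^ r - 2) := by
    generalize 2 ^ m * (2 ^ r - 1) = y
    generalize 2 ^ r = n at *
    generalize 2 ^ m = q at *
    obtain ⟨k, rfl⟩ := Nat.exists_eq_add_of_le hn
    obtain ⟨l, rfl⟩ := Nat.exists_eq_add_of_le hnq
    have a1 : 2 + k + l - (2 + k) = l := by omega
    have a2 : 2 + k + l - 2 = k + l := by omega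
    have a3 : 2 + k + y - 1 = 1 + k + y := by omega
    have a4 : 2 + k - 2 = k := by omega
    rw [a1, a2, a3, a4]
    ring
  rw [IsDennistonPDS, e1, e2, mul_comm 3 m, pow_mul]
  exact h
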